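/- For $m\ge 1$ write $[m]_q=1+q+\cdots+q^{m-1}$, let $(a;q)_0=1$ and $(a;q)_m=(1-a)(1-aq)\cdots(1-aq^{m-1})$, and let $\Phi_m(q)$ be the $m$-th cyclotomic polynomial. Two rational functions $A(q),B(q)\in\mathbb{Q}(q)$ are called congruent modulo a polynomial $P(q)$ if $P(q)$ divides, in $\mathbb{Q}[q]$, the numerator of $A(q)-B(q)$ written in lowest terms. Let $n$ be a positive integer with $n\equiv 3\pmod 4$. Then, modulo $\Phi_n(q)^2\,\Phi_{n^2}(q)^2$, $$\sum_{k=0}^{(n^2-1)/2}\frac{(1+q^{4k+1})\,(q^2;q^4)_k^3}{(1+q)\,(q^4;q^4)_k^3}\,q^k\equiv\frac{[n^2]_{q^2}\,(q^3;q^4)_{(n^2-1)/2}}{(q^5;q^4)_{(n^2-1)/2}}\,q^{(1-n^2)/2}$$ and $$\sum_{k=0}^{n^2-1}\frac{(1+q^{4k+1})\,(q^2;q^4)_k^3}{(1+q)\,(q^4;q^4)_k^3}\,q^k\equiv\frac{[n^2]_{q^2}\,(q^3;q^4)_{(n^2-1)/2}}{(q^5;q^4)_{(n^2-1)/2}}\,q^{(1-n^2)/2}.$$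 -/

import Mathlib

/-- The `q`-shifted factorial `(a; q)_n = (1 - a) (1 - a q) ⋯ (1 - a q ^ (n - 1))`. -/
def qShifted {R : Type*} [CommRing R] (a q : R) (n : ℕ) : R :=
  ∏ j ∈ Finset.range n, (1 - a * q ^ j)

/-- The `q`-integer `[n]_q = 1 + q + ⋯ + q ^ (n - 1)`. -/
def qInteger {R : Type*} [CommRing R] (n : ℕ) (q : R) : R :=
  ∑ j ∈ Finset.range n, q ^ j

/-- Congruence of two rational functions `A`, `B` over `ℚ` modulo a polynomial `P`:
`P` divides the numerator of `A - B`, written in lowest terms. -/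
def RatFuncCongr (P : Polynomial ℚ) (A B : RatFunc ℚ) : Prop :=
  P ∣ (A - B).num

/-- The summand `(1 + q ^ (4k+1)) (q²; q⁴)_k³ q ^ k / ((1 + q) (q⁴; q⁴)_k³)`,
with values in a field. -/
def summand {K : Type*} [Field K] (q : K) (k : ℕ) : K :=
  (1 + q ^ (4 * k + 1)) * qShifted (q ^ 2) (q ^ 4) k ^ 3 /
    ((1 + q) * qShifted (q ^ 4) (q ^ 4) k ^ 3) * q ^ k

/-- The product `[N]_{q²} (q³; q⁴)_{(N-1)/2} q ^ ((1-N)/2) / (q⁵; q⁴)_{(N-1)/2}`, with values in a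
field, for a positive odd integer `N`; both divisions of integers are then exact. -/
def closedForm {K : Type*} [Field K] (q : K) (N : ℕ) : K :=
  qInteger N (q ^ 2) * qShifted (q ^ 3) (q ^ 4) ((N - 1) / 2) /
    qShifted (q ^ 5) (q ^ 4) ((N - 1) / 2) * q ^ ((1 - (N : ℤ)) / 2)

/-! The moduli are coprime, so they are treated separately, each through its valuation `v` on
`ℚ(q)`; `P²`-divisibility of a numerator becomes `v f ≤ v (1 - q ^ n) ^ 2`.

Cut the sum into blocks of `n = 2m + 1` indices. In block `j`, up to a unit (`blockFactor`), the
summand involves `y = q ^ (4jn)` cubed. Modulo `Φ_n²` the three equal parameters may be replaced by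
any three that are `1` modulo `Φ_n` with the same product (`map_triple_sub_cube_le`). A suitable
choice turns the first `m + 1` terms into a terminating `₆φ₅` series, summed by `sum_wellPoised`;
the other `m` terms are negligible (`map_summand_le`).

For block `0` the value is the closed form exactly, which, with `n²` in place of `n`, settles
`Φ_{n²}²`. If `n ≡ 3 (mod 4)`, every block value vanishes modulo `Φ_n²` (`map_blockValue_le`), and
so does the closed form for `n²` (`map_closedForm_sq_le`). -/

section QShifted

variable {R : Type*} [CommRing R]

theorem qShifted_zero (a q : R) : qShifted a q 0 = 1 := by simp [qShifted]

theorem qShifted_succ (a q : R) (n : ℕ) :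
    qShifted a q (n + 1) = qShifted a q n * (1 - a * q ^ n) := by
  simp [qShifted, Finset.prod_range_succ]

theorem qShifted_add (a q : R) (m n : ℕ) :
    qShifted a q (m + n) = qShifted a q m * qShifted (a * q ^ m) q n := by
  simp [qShifted, Finset.prod_range_add, pow_add, mul_assoc]

theorem qShifted_succ' (a q : R) (n : ℕ) :
    qShifted a q (n + 1) = (1 - a) * qShifted (a * q) q n := by
  rw [add_comm, qShifted_add]
  simp [qShifted]

end QShifted

/-! ### The terminating `₆φ₅` summation -/

section SixPhiFive

variable {K : Type*} [Field K]

theorem qShifted_ne_zero {a q : K} {n : ℕ} (h : ∀ i, a * q ^ i ≠ 1) : qShifted a q n ≠ 0 :=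
  Finset.prod_ne_zero_iff.2 fun i _ => sub_ne_zero.2 (h i).symm

/-- The summand of the terminating very-well-poised `₆φ₅` series with base `p`. -/
def sixPhiFiveTerm (p a b c : K) (m k : ℕ) : K :=
  (1 - a * p ^ (2 * k)) / (1 - a) *
    (qShifted a p k * qShifted b p k * qShifted c p k * qShifted (p ^ m)⁻¹ p k /
      (qShifted p p k * qShifted (a * p / b) p k * qShifted (a * p / c) p k *
        qShifted (a * p ^ (m + 1)) p k)) * (a * p ^ (m + 1) / (b * c)) ^ k

/-- The certificate for the recurrence in `m` of the terminating `₆φ₅` series. -/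
def sixPhiFiveCert (p a b c : K) (m k : ℕ) : K :=
  qShifted (a * p) p k * qShifted b p (k + 1) * qShifted c p (k + 1) * qShifted (p ^ m)⁻¹ p k /
      (qShifted p p k * qShifted (a * p / b) p k * qShifted (a * p / c) p k *
        qShifted (a * p ^ (m + 2)) p k) * (a * p ^ (m + 1) / (b * c)) ^ (k + 1)

variable {p a b c : K}

/-- Creative telescoping in `m`: each step of the induction on `k` is a rational-function identity.
-/
theorem sixPhiFive_step (hp : p ≠ 0) (hb : b ≠ 0) (hc : c ≠ 0) (hpi : ∀ i, p * p ^ i ≠ 1)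
    (ha : ∀ i, a * p ^ i ≠ 1) (hab : ∀ i, a * p / b * p ^ i ≠ 1) (hac : ∀ i, a * p / c * p ^ i ≠ 1)
    (m k : ℕ) :
    ∑ i ∈ Finset.range (k + 1),
      ((1 - a * p ^ (m + 1) / b) * (1 - a * p ^ (m + 1) / c) * sixPhiFiveTerm p a b c (m + 1) i -
        (1 - a * p ^ (m + 1)) * (1 - a * p ^ (m + 1) / (b * c)) * sixPhiFiveTerm p a b c m i) =
      sixPhiFiveCert p a b c m k := by
  have ha0 : 1 - a ≠ 0 := sub_ne_zero.2 (by simpa using (ha 0).symm)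
  induction k with
  | zero =>
    simp only [zero_add, Finset.sum_range_one, sixPhiFiveTerm, sixPhiFiveCert, qShifted_zero,
      qShifted_succ]
    field_simp
    ring
  | succ k ih =>
    rw [Finset.sum_range_succ, ih]
    -- Shifting base points expresses all terms through the products in the certificate.
    have e1 : qShifted a p (k + 1) = (1 - a) * qShifted (a * p) p k := qShifted_succ' _ _ _
    have e2 : qShifted (p ^ (m + 1))⁻¹ p (k + 1) =
        (1 - (p ^ (m + 1))⁻¹) * qShifted (p ^ m)⁻¹ p k := by
      rw [qShifted_succ']; congr 2; field_simp; ring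
    have e3 : qShifted (a * p ^ (m + 1)) p (k + 1) =
        (1 - a * p ^ (m + 1)) * qShifted (a * p ^ (m + 2)) p k := by
      rw [qShifted_succ']; congr 2; ring
    have n1 : qShifted p p k ≠ 0 := qShifted_ne_zero hpi
    have n2 : qShifted (a * p / b) p k ≠ 0 := qShifted_ne_zero hab
    have n3 : qShifted (a * p / c) p k ≠ 0 := qShifted_ne_zero hac
    have n4 : qShifted (a * p ^ (m + 2)) p k ≠ 0 :=
      qShifted_ne_zero fun i => by rw [mul_assoc, ← pow_add]; exact ha _
    have d1 : 1 - p * p ^ k ≠ 0 := sub_ne_zero.2 (hpi k).symm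
    have d2 : 1 - a * p / b * p ^ k ≠ 0 := sub_ne_zero.2 (hab k).symm
    have d3 : 1 - a * p / c * p ^ k ≠ 0 := sub_ne_zero.2 (hac k).symm
    have d4 : 1 - a * p ^ (m + 2) * p ^ k ≠ 0 := sub_ne_zero.2 (by
      rw [mul_assoc, ← pow_add]; exact (ha _).symm)
    have d5 : 1 - a * p ^ (m + 1) ≠ 0 := sub_ne_zero.2 (ha _).symm
    simp only [sixPhiFiveTerm, sixPhiFiveCert]
    rw [e1, e2, e3, show m + 1 + 1 = m + 2 from rfl, qShifted_succ (a * p ^ (m + 2)),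
      qShifted_succ (p ^ m)⁻¹, qShifted_succ b p (k + 1), qShifted_succ c p (k + 1),
      qShifted_succ p, qShifted_succ (a * p / b), qShifted_succ (a * p / c), qShifted_succ (a * p)]
    generalize qShifted (a * p) p k = A1
    generalize qShifted b p (k + 1) = A2
    generalize qShifted c p (k + 1) = A3
    generalize qShifted (p ^ m)⁻¹ p k = A4
    generalize qShifted p p k = B1 at *
    generalize qShifted (a * p / b) p k = B2 at *
    generalize qShifted (a * p / c) p k = B3 at *
    generalize qShifted (a * p ^ (m + 2)) p k = B4 at *
    have hM : p ^ m ≠ 0 := pow_ne_zero _ hp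
    have hP : p ^ k ≠ 0 := pow_ne_zero _ hp
    have x1 : (a * p ^ (m + 2) / (b * c)) ^ (k + 1) =
        (a * p ^ (m + 1) / (b * c)) ^ (k + 1) * (p * p ^ k) := by
      rw [← pow_succ', ← mul_pow]; congr 1; ring
    rw [x1, pow_succ (a * p ^ (m + 1) / (b * c)) (k + 1)]
    generalize (a * p ^ (m + 1) / (b * c)) ^ (k + 1) = Z
    have x2 : p ^ (2 * (k + 1)) = (p ^ k) ^ 2 * p ^ 2 := by ring
    rw [x2]
    simp only [pow_succ p] at *
    generalize p ^ m = M at *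
    generalize p ^ k = P at *
    have d2' : b - a * p * P ≠ 0 := by
      intro h; apply d2; field_simp; linear_combination h
    have d3' : c - a * p * P ≠ 0 := by
      intro h; apply d3; field_simp; linear_combination h
    have d4' : 1 - a * M * p ^ 2 * P ≠ 0 := by convert d4 using 2; ring
    have d5' : 1 - a * M * p ≠ 0 := by convert d5 using 2; ring
    clear ih ha hab hac hpi x1 x2
    field_simp
    ring

theorem qShifted_inv_pow_eq_zero (hp : p ≠ 0) (m : ℕ) : qShifted (p ^ m)⁻¹ p (m + 1) = 0 := by
  rw [qShifted_succ, inv_mul_cancel₀ (pow_ne_zero _ hp), sub_self, mul_zero]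

/-- The sum of the terminating very-well-poised `₆φ₅` series. -/
theorem sum_sixPhiFiveTerm (hp : p ≠ 0) (hb : b ≠ 0) (hc : c ≠ 0) (hpi : ∀ i, p * p ^ i ≠ 1)
    (ha : ∀ i, a * p ^ i ≠ 1) (hab : ∀ i, a * p / b * p ^ i ≠ 1) (hac : ∀ i, a * p / c * p ^ i ≠ 1)
    (m : ℕ) :
    ∑ i ∈ Finset.range (m + 1), sixPhiFiveTerm p a b c m i =
      qShifted (a * p) p m * qShifted (a * p / (b * c)) p m /
        (qShifted (a * p / b) p m * qShifted (a * p / c) p m) := by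
  have ha0 : 1 - a ≠ 0 := sub_ne_zero.2 (by simpa using (ha 0).symm)
  induction m with
  | zero => simp [sixPhiFiveTerm, qShifted_zero, div_self ha0]
  | succ m ih =>
    -- At `k = m + 1` the factor `(p⁻ᵐ; p)_k` kills both the certificate and the extra term, leaving
    -- a first-order recurrence.
    have h := sixPhiFive_step hp hb hc hpi ha hab hac m (m + 1)
    have h0 : sixPhiFiveTerm p a b c m (m + 1) = 0 := by
      simp [sixPhiFiveTerm, qShifted_inv_pow_eq_zero hp]
    rw [Finset.sum_sub_distrib, ← Finset.mul_sum, ← Finset.mul_sum,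
      Finset.sum_range_succ (sixPhiFiveTerm p a b c m), ih, h0, add_zero,
      show sixPhiFiveCert p a b c m (m + 1) = 0 by
        simp [sixPhiFiveCert, qShifted_inv_pow_eq_zero hp], sub_eq_zero] at h
    have d2 : 1 - a * p / b * p ^ m ≠ 0 := sub_ne_zero.2 (hab m).symm
    have d3 : 1 - a * p / c * p ^ m ≠ 0 := sub_ne_zero.2 (hac m).symm
    have n2 : qShifted (a * p / b) p m ≠ 0 := qShifted_ne_zero hab
    have n3 : qShifted (a * p / c) p m ≠ 0 := qShifted_ne_zero hac
    have e (x : K) : a * p ^ (m + 1) / x = a * p / x * p ^ m := by ring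
    rw [e, e, e] at h
    simp only [qShifted_succ]
    rw [eq_div_iff (by positivity)]
    have e' : a * p ^ (m + 1) = a * p * p ^ m := by ring
    rw [e', mul_div_assoc', eq_div_iff (mul_ne_zero n2 n3)] at h
    linear_combination h

/-- A specialization of the `₆φ₅` sum in which the summand has three parameters of product
`(y q ^ 2) ^ 3` over three parameters of product `(y q ^ 4) ^ 3`. -/
theorem sum_wellPoised {q y s : K} {m : ℕ} (hs : s = q ^ (4 * m + 2)) (hq : q ≠ 0) (hy : y ≠ 0)
    (h1 : ∀ i, q ^ 4 * (q ^ 4) ^ i ≠ 1) (h2 : ∀ i, y ^ 2 * q ^ 2 * (q ^ 4) ^ i ≠ 1)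
    (h3 : ∀ i, y * q * (q ^ 4) ^ i ≠ 1) (h4 : ∀ i, y / s * q ^ 4 * (q ^ 4) ^ i ≠ 1) :
    ∑ r ∈ Finset.range (m + 1), (1 + y * q ^ (4 * r + 1)) * q ^ r *
      (qShifted (y ^ 2 * q ^ 2) (q ^ 4) r * qShifted (y * s * q ^ 2) (q ^ 4) r *
          qShifted (s⁻¹ * q ^ 2) (q ^ 4) r /
        (qShifted (1 * q ^ 4) (q ^ 4) r * qShifted (y / s * q ^ 4) (q ^ 4) r *
          qShifted (y ^ 2 * s * q ^ 4) (q ^ 4) r)) =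
      (1 + y * q) * (qShifted (y ^ 2 * q ^ 6) (q ^ 4) m * qShifted (s⁻¹ * q ^ 3) (q ^ 4) m /
        (qShifted (y * q ^ 5) (q ^ 4) m * qShifted (y / s * q ^ 4) (q ^ 4) m)) := by
  have hs0 : s ≠ 0 := hs ▸ pow_ne_zero _ hq
  have e1 : y ^ 2 * q ^ 2 * q ^ 4 / (y * q) = y * q ^ 5 := by field_simp
  have e2 : y ^ 2 * q ^ 2 * q ^ 4 / (y * s * q ^ 2) = y / s * q ^ 4 := by field_simp
  have e3 : y ^ 2 * q ^ 2 * q ^ 4 / (y * q * (y * s * q ^ 2)) = s⁻¹ * q ^ 3 := by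
    field_simp
  have e4 : ((q ^ 4) ^ m)⁻¹ = s⁻¹ * q ^ 2 := by
    rw [hs, pow_add, ← pow_mul]; field_simp
  have e5 : y ^ 2 * q ^ 2 * (q ^ 4) ^ (m + 1) = y ^ 2 * s * q ^ 4 := by rw [hs]; ring
  have e6 : y ^ 2 * s * q ^ 4 / (y * q * (y * s * q ^ 2)) = q := by field_simp
  have e7 : y ^ 2 * q ^ 2 * q ^ 4 = y ^ 2 * q ^ 6 := by ring
  have h3' (i : ℕ) : y * q ^ 5 * (q ^ 4) ^ i ≠ 1 := by convert h3 (i + 1) using 1; ring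
  -- Here `b² = a`, so `a p / b = b p`, and `c` makes the argument of the series equal to `q`.
  have key := sum_sixPhiFiveTerm (p := q ^ 4) (a := y ^ 2 * q ^ 2) (b := y * q)
    (c := y * s * q ^ 2) (pow_ne_zero _ hq) (by positivity) (by positivity) h1 h2
    (by simpa only [e1] using h3') (by simpa only [e2] using h4) m
  rw [e1, e2, e3, e7] at key
  rw [← key, Finset.mul_sum]
  refine Finset.sum_congr rfl fun r _ => ?_
  simp only [sixPhiFiveTerm]
  rw [e1, e2, e4, e5, e6, one_mul]
  -- The quotient `(b; p)_r / (b p; p)_r` collapses and cancels half of the very-well-poised factor.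
  have h : qShifted (y * q) (q ^ 4) r * (1 - y * q ^ (4 * r + 1)) =
      (1 - y * q) * qShifted (y * q ^ 5) (q ^ 4) r := by
    have := (qShifted_succ (y * q) (q ^ 4) r).symm.trans (qShifted_succ' _ _ _)
    convert this using 3 <;> ring
  have d0 : 1 - y * q ≠ 0 := sub_ne_zero.2 (by simpa using (h3 0).symm)
  have d1 : 1 - y ^ 2 * q ^ 2 ≠ 0 := sub_ne_zero.2 (by simpa using (h2 0).symm)
  have d2 : 1 + y * q ≠ 0 := fun h => d1 (by linear_combination (1 - y * q) * h)
  have d3 : qShifted (y * q ^ 5) (q ^ 4) r ≠ 0 := qShifted_ne_zero h3'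
  have x1 : (1 - y ^ 2 * q ^ 2 * (q ^ 4) ^ (2 * r)) / (1 - y ^ 2 * q ^ 2) * qShifted (y * q) (q ^ 4) r =
      (1 + y * q ^ (4 * r + 1)) / (1 + y * q) * qShifted (y * q ^ 5) (q ^ 4) r := by
    rw [div_mul_eq_mul_div, div_mul_eq_mul_div, div_eq_div_iff d1 d2]
    have : y ^ 2 * q ^ 2 * (q ^ 4) ^ (2 * r) = (y * q ^ (4 * r + 1)) ^ 2 := by ring
    rw [this]
    linear_combination (1 + y * q ^ (4 * r + 1)) * (1 + y * q) * h
  generalize qShifted (y ^ 2 * q ^ 2) (q ^ 4) r = A1 at *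
  generalize qShifted (y * s * q ^ 2) (q ^ 4) r = A2 at *
  generalize qShifted (s⁻¹ * q ^ 2) (q ^ 4) r = A3 at *
  generalize qShifted (q ^ 4) (q ^ 4) r = B1 at *
  generalize qShifted (y / s * q ^ 4) (q ^ 4) r = B2 at *
  generalize qShifted (y ^ 2 * s * q ^ 4) (q ^ 4) r = B3 at *
  generalize qShifted (y * q) (q ^ 4) r = A4 at *
  generalize qShifted (y * q ^ 5) (q ^ 4) r = B4 at *
  calc _ = (1 + y * q) * ((1 + y * q ^ (4 * r + 1)) / (1 + y * q) * B4) *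
        (A1 * A2 * A3 / (B1 * B2 * B3)) / B4 * q ^ r := by field_simp
    _ = _ := by rw [← x1]; ring

end SixPhiFive

/-! ### Congruences as valuation inequalities -/

section Congruence

variable {K : Type*} [Field K] {Γ₀ : Type*} [LinearOrderedCommGroupWithZero Γ₀]
  {v : Valuation K Γ₀} {γ : Γ₀}

namespace Valuation

theorem map_mul_sub_mul_le {a b a' b' : K} (ha' : v a' ≤ 1) (hb : v b ≤ 1)
    (h : v (a - a') ≤ γ) (h' : v (b - b') ≤ γ) : v (a * b - a' * b') ≤ γ := by
  have e : a * b - a' * b' = (a - a') * b + a' * (b - b') := by ring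
  rw [e]
  refine v.map_add_le ?_ ?_
  · rw [map_mul]; exact (mul_le_mul' h hb).trans_eq (mul_one _)
  · rw [map_mul]; exact (mul_le_mul' ha' h').trans_eq (one_mul _)

theorem map_div_sub_div_le {a b a' b' : K} (ha' : v a' ≤ 1) (hb : v b = 1) (hb' : v b' = 1)
    (h : v (a - a') ≤ γ) (h' : v (b - b') ≤ γ) : v (a / b - a' / b') ≤ γ := by
  have h0 : b ≠ 0 := (v.ne_zero_iff).1 (by simp [hb])
  have h0' : b' ≠ 0 := (v.ne_zero_iff).1 (by simp [hb'])
  have e : a / b - a' / b' = ((a - a') * b' - a' * (b - b')) / (b * b') := by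
    field_simp; ring
  rw [e, map_div₀, map_mul, hb, hb', mul_one, div_one]
  refine v.map_sub_le ?_ ?_
  · rwa [map_mul, hb', mul_one]
  · rw [map_mul]; exact (mul_le_mul' ha' h').trans_eq (one_mul _)

theorem map_prod_sub_prod_le {ι : Type*} (s : Finset ι) {f g : ι → K} (hf : ∀ i ∈ s, v (f i) ≤ 1)
    (hg : ∀ i ∈ s, v (g i) ≤ 1) (h : ∀ i ∈ s, v (f i - g i) ≤ γ) :
    v (∏ i ∈ s, f i - ∏ i ∈ s, g i) ≤ γ := by
  classical
  induction s using Finset.induction_on with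
  | empty => simp
  | insert a s ha ih =>
    simp only [Finset.mem_insert, forall_eq_or_imp] at hf hg h
    rw [Finset.prod_insert ha, Finset.prod_insert ha]
    refine map_mul_sub_mul_le hg.1 ?_ h.1 (ih hf.2 hg.2 h.2)
    rw [map_prod]
    exact Finset.prod_le_one' hf.2

theorem map_eq_one_of_sub_lt {a b : K} (hb : v b = 1) (h : v (a - b) < 1) : v a = 1 := by
  rw [← hb, ← v.map_sub_eq_of_lt_right (x := b - a) (y := b)]
  · simp
  · rwa [hb, v.map_sub_swap]

theorem map_sub_one_mul_le {u w : K} (hu : v u ≤ 1) (h : v (u - 1) ≤ γ) (h' : v (w - 1) ≤ γ) :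
    v (u * w - 1) ≤ γ := by
  have e : u * w - 1 = (u - 1) + u * (w - 1) := by ring
  rw [e]
  refine v.map_add_le h ?_
  rw [map_mul]; exact (mul_le_mul' hu h').trans_eq (one_mul _)

theorem map_one_sub_mul_le {u Q : K} (hQ : v Q ≤ 1) (h : v (u - 1) ≤ γ) (h' : v (1 - Q) ≤ γ) :
    v (1 - u * Q) ≤ γ := by
  have e : 1 - u * Q = (1 - Q) - (u - 1) * Q := by ring
  rw [e]
  refine v.map_sub_le h' ?_
  rw [map_mul]; exact (mul_le_mul' h hQ).trans_eq (mul_one _)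

theorem map_one_sub_mul_eq_one {u Q : K} (hQ : v Q ≤ 1) (h : v (u - 1) < 1)
    (h' : v (1 - Q) = 1) : v (1 - u * Q) = 1 := by
  refine map_eq_one_of_sub_lt h' ?_
  have e : 1 - u * Q - (1 - Q) = (1 - u) * Q := by ring
  rw [e, map_mul, v.map_sub_swap]
  exact mul_lt_one_of_lt_of_le h hQ

theorem map_le_one_of_map_sub_one_le {u : K} (hγ : γ ≤ 1) (h : v (u - 1) ≤ γ) : v u ≤ 1 := by
  have := v.map_add_le (h.trans hγ) v.map_one.le
  rwa [sub_add_cancel] at this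

/-- The product condition forces `∑ (uᵢ - 1)` and `3 (y - 1)` to agree to second order, so the
first-order parts cancel. -/
theorem map_triple_sub_cube_le {u₁ u₂ u₃ y Q : K} (hγ : γ ≤ 1) (h₁ : v (u₁ - 1) ≤ γ)
    (h₂ : v (u₂ - 1) ≤ γ) (h₃ : v (u₃ - 1) ≤ γ) (hy : v (y - 1) ≤ γ) (hQ : v Q ≤ 1)
    (h : u₁ * u₂ * u₃ = y ^ 3) :
    v ((1 - u₁ * Q) * (1 - u₂ * Q) * (1 - u₃ * Q) - (1 - y * Q) ^ 3) ≤ γ ^ 2 := by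
  have sq {a b c : K} (ha : v a ≤ γ) (hb : v b ≤ γ) (hc : c ∈ v.integer) :
      v (a * b * c) ≤ γ ^ 2 := by
    rw [map_mul, map_mul, sq]
    exact (mul_le_mul' (mul_le_mul' ha hb) hc).trans_eq (mul_one _)
  have hQ' : Q ∈ v.integer := hQ
  have i₃ : u₃ ∈ v.integer := map_le_one_of_map_sub_one_le hγ h₃
  have iy : y ∈ v.integer := map_le_one_of_map_sub_one_le hγ hy
  have i2 : (2 : K) ∈ v.integer := ofNat_mem _ 2
  have i3 : (3 : K) ∈ v.integer := ofNat_mem _ 3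
  -- Every term on the right carries two small differences.
  have e : (1 - u₁ * Q) * (1 - u₂ * Q) * (1 - u₃ * Q) - (1 - y * Q) ^ 3 =
      (u₁ - 1) * (u₂ - 1) * (Q * u₃ + Q ^ 2 * (1 - 2 * u₃)) +
      (u₁ - 1) * (u₃ - 1) * (Q - Q ^ 2) + (u₂ - 1) * (u₃ - 1) * (Q - Q ^ 2) +
      (y - 1) * (y - 1) * (Q ^ 2 * (2 * (y + 2) - 3) - Q * (y + 2)) := by
    linear_combination (2 * Q ^ 2 - Q - Q ^ 3) * h
  rw [e]
  have a1 : Q * u₃ + Q ^ 2 * (1 - 2 * u₃) ∈ v.integer :=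
    add_mem (mul_mem hQ' i₃) (mul_mem (pow_mem hQ' 2) (sub_mem (one_mem _) (mul_mem i2 i₃)))
  have a2 : Q - Q ^ 2 ∈ v.integer := sub_mem hQ' (pow_mem hQ' 2)
  have a3 : Q ^ 2 * (2 * (y + 2) - 3) - Q * (y + 2) ∈ v.integer :=
    sub_mem (mul_mem (pow_mem hQ' 2) (sub_mem (mul_mem i2 (add_mem iy i2)) i3))
      (mul_mem hQ' (add_mem iy i2))
  exact v.map_add_le (v.map_add_le (v.map_add_le (sq h₁ h₂ a1) (sq h₁ h₃ a2)) (sq h₂ h₃ a2))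
    (sq hy hy a3)

end Valuation

end Congruence

/-! ### Cyclotomic places -/

section Place

variable {K : Type*} [Field K] {Γ₀ : Type*} [LinearOrderedCommGroupWithZero Γ₀]

/-- The valuation `v` of `K` behaves on the elements `1 - q ^ e` like the `Φ_n(q)`-adic one. -/
structure IsCyclotomicPlace (v : Valuation K Γ₀) (q : K) (n : ℕ) : Prop where
  map_q : v q = 1
  lt_one : v (1 - q ^ n) < 1
  pow_ne_one : ∀ e, e ≠ 0 → q ^ e ≠ 1
  eq_one : ∀ e, ¬ n ∣ e → v (1 - q ^ e) = 1
  eq_of_dvd : ∀ e, e ≠ 0 → n ∣ e → v (1 - q ^ e) = v (1 - q ^ n)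

namespace IsCyclotomicPlace

variable {v : Valuation K Γ₀} {q : K} {n : ℕ}

theorem ne_zero (h : IsCyclotomicPlace v q n) : q ≠ 0 := v.ne_zero_iff.1 (by simp [h.map_q])

theorem map_pow (h : IsCyclotomicPlace v q n) (e : ℕ) : v (q ^ e) = 1 := by simp [h.map_q]

theorem le_of_dvd (h : IsCyclotomicPlace v q n) {e : ℕ} (he : n ∣ e) :
    v (1 - q ^ e) ≤ v (1 - q ^ n) := by
  rcases eq_or_ne e 0 with rfl | h0
  · simp
  · exact (h.eq_of_dvd e h0 he).le

theorem pow_sub_one_le (h : IsCyclotomicPlace v q n) {e : ℕ} (he : n ∣ e) :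
    v (q ^ e - 1) ≤ v (1 - q ^ n) := by
  rw [v.map_sub_swap]; exact h.le_of_dvd he

theorem pow_inj (h : IsCyclotomicPlace v q n) {a b : ℕ} (hab : q ^ a = q ^ b) : a = b := by
  wlog hlt : a < b generalizing a b
  · by_contra hne
    exact hne (this hab.symm (by omega)).symm
  obtain ⟨c, rfl⟩ := Nat.exists_eq_add_of_lt hlt
  refine absurd ?_ (h.pow_ne_one (c + 1) (by omega))
  rw [add_assoc, pow_add] at hab
  exact (mul_right_cancel₀ (pow_ne_zero a h.ne_zero) (by rw [one_mul, mul_comm]; exact hab)).symm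

theorem map_one_add (h : IsCyclotomicPlace v q n) {e : ℕ} (he : ¬ n ∣ 2 * e) :
    v (1 + q ^ e) = 1 := by
  have h1 := h.eq_one _ he
  have h2 := h.eq_one e fun hd => he (hd.mul_left 2)
  rw [show (1 : K) - q ^ (2 * e) = (1 - q ^ e) * (1 + q ^ e) by ring, map_mul, h2, one_mul] at h1
  exact h1

theorem map_qShifted_le_one {a q : K} (ha : v a ≤ 1) (hq : v q ≤ 1) (r : ℕ) :
    v (qShifted a q r) ≤ 1 := by
  rw [qShifted, map_prod]
  refine Finset.prod_le_one' fun i _ => v.map_sub_le v.map_one.le ?_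
  rw [map_mul, _root_.map_pow]
  exact mul_le_one' ha (pow_le_one' hq i)

theorem map_qShifted_eq_one {a q : K} {r : ℕ} (h : ∀ i < r, v (1 - a * q ^ i) = 1) :
    v (qShifted a q r) = 1 := by
  rw [qShifted, map_prod]
  exact Finset.prod_eq_one fun i hi => h i (Finset.mem_range.1 hi)

theorem map_qShifted_le {a q : K} {r i : ℕ} {γ : Γ₀} (ha : v a ≤ 1) (hq : v q ≤ 1) (hi : i < r)
    (h : v (1 - a * q ^ i) ≤ γ) : v (qShifted a q r) ≤ γ := by
  rw [qShifted, ← Finset.mul_prod_erase _ _ (Finset.mem_range.2 hi), map_mul, map_prod]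
  refine (mul_le_mul' h (Finset.prod_le_one' fun j _ => v.map_sub_le v.map_one.le ?_)).trans_eq
    (mul_one _)
  rw [map_mul, _root_.map_pow]
  exact mul_le_one' ha (pow_le_one' hq j)

theorem map_qShifted_triple_sub_cube_le {u₁ u₂ u₃ y Q q : K} {γ : Γ₀} (hγ : γ ≤ 1)
    (h₁ : v (u₁ - 1) ≤ γ) (h₂ : v (u₂ - 1) ≤ γ) (h₃ : v (u₃ - 1) ≤ γ) (hy : v (y - 1) ≤ γ)
    (hQ : v Q ≤ 1) (hq : v q ≤ 1) (h : u₁ * u₂ * u₃ = y ^ 3) (r : ℕ) :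
    v (qShifted (u₁ * Q) q r * qShifted (u₂ * Q) q r * qShifted (u₃ * Q) q r -
      qShifted (y * Q) q r ^ 3) ≤ γ ^ 2 := by
  have hQi (i : ℕ) : v (Q * q ^ i) ≤ 1 := by
    rw [map_mul, _root_.map_pow]; exact mul_le_one' hQ (pow_le_one' hq i)
  have int {u : K} (hu : v (u - 1) ≤ γ) (i : ℕ) : v (1 - u * (Q * q ^ i)) ≤ 1 := by
    refine v.map_sub_le v.map_one.le ?_
    rw [map_mul]
    exact mul_le_one' (Valuation.map_le_one_of_map_sub_one_le hγ hu) (hQi i)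
  simp only [qShifted, ← Finset.prod_mul_distrib, ← Finset.prod_pow, mul_assoc _ Q]
  refine Valuation.map_prod_sub_prod_le _ (fun i _ => ?_) (fun i _ => ?_) fun i _ =>
    Valuation.map_triple_sub_cube_le hγ h₁ h₂ h₃ hy (hQi i) h
  · rw [map_mul, map_mul]
    exact mul_le_one' (mul_le_one' (int h₁ i) (int h₂ i)) (int h₃ i)
  · rw [_root_.map_pow]; exact pow_le_one' (int hy i) 3

end IsCyclotomicPlace

end Place

/-- Since `4` is invertible modulo odd `n`, any `n` consecutive factors in base `q ^ 4` include
exactly one with exponent divisible by `n`. -/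
theorem exists_unique_dvd_add_four_mul {n : ℕ} (hn : Odd n) (e : ℕ) :
    ∃ i < n, n ∣ e + 4 * i ∧ ∀ j < n, n ∣ e + 4 * j → j = i := by
  have hc : Nat.Coprime 4 n := by
    rw [show 4 = 2 ^ 2 by rfl]
    exact Nat.Coprime.pow_left 2 (Nat.coprime_two_left.2 hn)
  have : NeZero n := ⟨hn.pos.ne'⟩
  have hu : (4 : ZMod n) * (4 : ZMod n)⁻¹ = 1 := by exact_mod_cast ZMod.coe_mul_inv_eq_one 4 hc
  have key (j : ℕ) : n ∣ e + 4 * j ↔ (j : ZMod n) = -e * (4 : ZMod n)⁻¹ := by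
    rw [← ZMod.natCast_eq_zero_iff]
    push_cast
    constructor
    · intro h; linear_combination (4 : ZMod n)⁻¹ * h - (j : ZMod n) * hu
    · intro h; linear_combination 4 * h - (e : ZMod n) * hu
  refine ⟨(-e * (4 : ZMod n)⁻¹).val, ZMod.val_lt _, (key _).2 (by simp), fun j hj h => ?_⟩
  rw [← (key j).1 h, ZMod.val_natCast_of_lt hj]

/-! ### Valuations over blocks of `n` indices -/

namespace IsCyclotomicPlace

variable {K : Type*} [Field K] {Γ₀ : Type*} [LinearOrderedCommGroupWithZero Γ₀]
  {v : Valuation K Γ₀} {q : K} {n : ℕ}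

theorem map_qShifted_self (h : IsCyclotomicPlace v q n) (hn : Odd n) {e : ℕ} (he : e ≠ 0) :
    v (qShifted (q ^ e) (q ^ 4) n) = v (1 - q ^ n) := by
  obtain ⟨i, hi, hd, huniq⟩ := exists_unique_dvd_add_four_mul hn e
  rw [qShifted, map_prod, Finset.prod_eq_single_of_mem i (Finset.mem_range.2 hi)]
  · rw [← pow_mul, ← pow_add, h.eq_of_dvd _ (by omega) hd]
  · intro j hj hji
    rw [← pow_mul, ← pow_add]
    exact h.eq_one _ fun hd' => hji (huniq j (Finset.mem_range.1 hj) hd')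

theorem map_qShifted_mul (h : IsCyclotomicPlace v q n) (hn : Odd n) {e : ℕ} (he : e ≠ 0) (j : ℕ) :
    v (qShifted (q ^ e) (q ^ 4) (j * n)) = v (1 - q ^ n) ^ j := by
  induction j with
  | zero => simp [qShifted_zero]
  | succ j ih =>
    rw [add_mul, one_mul, qShifted_add, map_mul, ih, pow_succ (v _), ← pow_mul, ← pow_add,
      h.map_qShifted_self hn (by omega)]

theorem map_one_sub_ne_zero (h : IsCyclotomicPlace v q n) (hn : n ≠ 0) : v (1 - q ^ n) ≠ 0 :=
  v.ne_zero_iff.2 (sub_ne_zero.2 (h.pow_ne_one n hn).symm)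

/-- The factor relating the summands with indices `j * n + r` to those with index `r`. -/
def blockFactor {K : Type*} [Field K] (q : K) (n j : ℕ) : K :=
  (qShifted (q ^ 2) (q ^ 4) (j * n) / qShifted (q ^ 4) (q ^ 4) (j * n)) ^ 3 * q ^ (j * n) / (1 + q)

/-- Both products vanish to the same order, whatever their starting exponent, and `1 + q` is a unit
because `n ∤ 2`. -/
theorem map_blockFactor (h : IsCyclotomicPlace v q n) (hn : Odd n) (h1 : n ≠ 1) (j : ℕ) :
    v (blockFactor q n j) = 1 := by
  have h2 : ¬ n ∣ 2 * 1 := by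
    intro hd
    have := Nat.le_of_dvd two_pos hd
    obtain ⟨k, rfl⟩ := hn
    omega
  have h3 := h.map_one_add h2
  rw [pow_one] at h3
  rw [blockFactor, map_div₀, map_mul, _root_.map_pow, map_div₀, h.map_qShifted_mul hn (by norm_num),
    h.map_qShifted_mul hn (by norm_num), div_self, h3, h.map_pow]
  · simp
  · exact pow_ne_zero _ (h.map_one_sub_ne_zero hn.pos.ne')

theorem summand_eq_blockFactor_mul (q : K) (n j r : ℕ) :
    summand q (j * n + r) = blockFactor q n j *
      ((1 + q ^ (4 * (j * n)) * q ^ (4 * r + 1)) * q ^ r *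
        (qShifted (q ^ (4 * (j * n)) * q ^ 2) (q ^ 4) r ^ 3 /
          qShifted (q ^ (4 * (j * n)) * q ^ 4) (q ^ 4) r ^ 3)) := by
  have e2 : q ^ 2 * (q ^ 4) ^ (j * n) = q ^ (4 * (j * n)) * q ^ 2 := by ring
  have e4 : q ^ 4 * (q ^ 4) ^ (j * n) = q ^ (4 * (j * n)) * q ^ 4 := by ring
  have e5 : q ^ (4 * (j * n + r) + 1) = q ^ (4 * (j * n)) * q ^ (4 * r + 1) := by ring
  rw [summand, qShifted_add, qShifted_add, e2, e4, e5, pow_add q (j * n) r, blockFactor]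
  simp only [div_eq_mul_inv, mul_inv, mul_pow, inv_pow]
  ring

theorem not_dvd_four_mul {n i : ℕ} (hn : Odd n) (hi : i + 1 < n) : ¬ n ∣ 4 + 4 * i := by
  intro hd
  have hc : Nat.Coprime n 4 := by
    rw [show 4 = 2 ^ 2 by rfl]
    exact Nat.Coprime.pow_right 2 (Nat.coprime_two_right.2 hn)
  have := hc.dvd_of_dvd_mul_left (show n ∣ 4 * (i + 1) by convert hd using 1; ring)
  exact absurd (Nat.le_of_dvd (by omega) this) (by omega)

theorem map_qShifted_four (h : IsCyclotomicPlace v q n) (hn : Odd n) {u : K}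
    (hu : v (u - 1) ≤ v (1 - q ^ n)) {r : ℕ} (hr : r < n) :
    v (qShifted (u * q ^ 4) (q ^ 4) r) = 1 := by
  refine map_qShifted_eq_one fun i hi => ?_
  rw [mul_assoc, ← pow_mul, ← pow_add]
  exact Valuation.map_one_sub_mul_eq_one (h.map_pow _).le (hu.trans_lt h.lt_one)
    (h.eq_one _ (not_dvd_four_mul hn (by omega)))

theorem map_qShifted_le_of_dvd (h : IsCyclotomicPlace v q n) {u : K}
    (hu : v (u - 1) ≤ v (1 - q ^ n)) {e i r : ℕ} (hi : i < r) (hd : n ∣ e + 4 * i) :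
    v (qShifted (u * q ^ e) (q ^ 4) r) ≤ v (1 - q ^ n) := by
  have hu1 : v u ≤ 1 := Valuation.map_le_one_of_map_sub_one_le h.lt_one.le hu
  refine map_qShifted_le ?_ (h.map_pow 4).le hi ?_
  · rw [map_mul, h.map_pow, mul_one]; exact hu1
  · rw [mul_assoc, ← pow_mul, ← pow_add]
    exact Valuation.map_one_sub_mul_le (h.map_pow _).le hu (h.le_of_dvd hd)

theorem map_summand_le (h : IsCyclotomicPlace v q n) {m : ℕ} (hn : n = 2 * m + 1) (h1 : n ≠ 1)
    (j : ℕ) {r : ℕ} (hmr : m < r) (hr : r < n) :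
    v (summand q (j * n + r)) ≤ v (1 - q ^ n) ^ 2 := by
  have hodd : Odd n := ⟨m, hn⟩
  have hy : v (q ^ (4 * (j * n)) - 1) ≤ v (1 - q ^ n) :=
    h.pow_sub_one_le (Dvd.intro_left _ (by ring : 4 * j * n = _))
  rw [summand_eq_blockFactor_mul, map_mul, h.map_blockFactor hodd h1, one_mul, map_mul, map_div₀,
    _root_.map_pow v (qShifted _ _ _), _root_.map_pow v (qShifted _ _ _),
    h.map_qShifted_four hodd hy hr, one_pow, div_one]
  -- The factor of index `m` has exponent `4m + 2 = 2n`; it occurs cubed.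
  have hle := h.map_qShifted_le_of_dvd hy (e := 2) hmr (Dvd.intro 2 (by omega))
  have ha : v ((1 + q ^ (4 * (j * n)) * q ^ (4 * r + 1)) * q ^ r) ≤ 1 := by
    rw [map_mul, h.map_pow, mul_one, ← pow_add]
    exact v.map_add_le v.map_one.le (h.map_pow _).le
  calc _ ≤ 1 * v (1 - q ^ n) ^ 3 := mul_le_mul' ha (pow_le_pow_left' hle 3)
    _ ≤ v (1 - q ^ n) ^ 2 := by
      rw [one_mul]; exact pow_le_pow_right_of_le_one' h.lt_one.le (by norm_num)

end IsCyclotomicPlace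

/-! ### Block sums and the closed form -/

namespace IsCyclotomicPlace

variable {K : Type*} [Field K] {Γ₀ : Type*} [LinearOrderedCommGroupWithZero Γ₀]
  {v : Valuation K Γ₀} {q : K} {n : ℕ}

theorem map_inv_pow_sub_one_le (h : IsCyclotomicPlace v q n) {e : ℕ} (he : n ∣ e) :
    v ((q ^ e)⁻¹ - 1) ≤ v (1 - q ^ n) := by
  have e1 : (q ^ e)⁻¹ - 1 = (1 - q ^ e) / q ^ e := by
    rw [sub_div, div_self (pow_ne_zero _ h.ne_zero), one_div]
  rw [e1, map_div₀, h.map_pow, div_one]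
  exact h.le_of_dvd he

/-- The value of the `₆φ₅` series to which the sum of the summands with indices `j * n + r`, for
`n = 2 * m + 1` and `r ≤ m`, is congruent up to a factor, with `y = q ^ (4 * j * n)`. -/
def blockValue {K : Type*} [Field K] (q y : K) (m : ℕ) : K :=
  qShifted (y ^ 2 * q ^ 6) (q ^ 4) m * qShifted ((q ^ (4 * m + 2))⁻¹ * q ^ 3) (q ^ 4) m /
    (qShifted (y * q ^ 5) (q ^ 4) m * qShifted (y / q ^ (4 * m + 2) * q ^ 4) (q ^ 4) m)

/-- Termwise comparison with the `₆φ₅` series; for `r ≤ m < n` all denominators are units. -/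
theorem map_sum_block_sub_le (h : IsCyclotomicPlace v q n) {m : ℕ} (hn : n = 2 * m + 1)
    (h1 : n ≠ 1) (j : ℕ) :
    v (∑ r ∈ Finset.range (m + 1), summand q (j * n + r) - blockFactor q n j *
      ((1 + q ^ (4 * (j * n)) * q) * blockValue q (q ^ (4 * (j * n))) m)) ≤ v (1 - q ^ n) ^ 2 := by
  have hodd : Odd n := ⟨m, hn⟩
  have hw := h.lt_one.le
  have hs : n ∣ 4 * m + 2 := Dvd.intro 2 (by omega)
  have hyd : n ∣ 4 * (j * n) := Dvd.intro_left (4 * j) (by ring)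
  have hy : v (q ^ (4 * (j * n)) - 1) ≤ v (1 - q ^ n) := h.pow_sub_one_le hyd
  have hy2 : v ((q ^ (4 * (j * n))) ^ 2 - 1) ≤ v (1 - q ^ n) := by
    rw [← pow_mul]; exact h.pow_sub_one_le (hyd.mul_right 2)
  have hσ := h.pow_sub_one_le hs
  have hσ' := h.map_inv_pow_sub_one_le hs
  have hy1 := (h.map_pow (4 * (j * n))).le
  rw [blockValue, ← sum_wellPoised (q := q) (y := q ^ (4 * (j * n))) rfl h.ne_zero
    (pow_ne_zero _ h.ne_zero)]
  rotate_left
  · intro i; rw [← pow_mul, ← pow_add]; exact h.pow_ne_one _ (by omega)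
  · intro i; rw [← pow_mul, ← pow_mul, ← pow_add, ← pow_add]; exact h.pow_ne_one _ (by omega)
  · intro i; rw [← pow_succ, ← pow_mul, ← pow_add]; exact h.pow_ne_one _ (by omega)
  -- Equality would make `4m + 2` a multiple of `4`.
  · intro i hi
    rw [div_mul_eq_mul_div, div_mul_eq_mul_div, div_eq_one_iff_eq (pow_ne_zero _ h.ne_zero),
      ← pow_mul, ← pow_add, ← pow_add] at hi
    have := h.pow_inj hi
    omega
  simp only [summand_eq_blockFactor_mul]
  rw [← Finset.mul_sum, ← mul_sub, map_mul, h.map_blockFactor hodd h1, one_mul,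
    ← Finset.sum_sub_distrib]
  generalize hY : q ^ (4 * (j * n)) = y at *
  generalize hS : q ^ (4 * m + 2) = s at *
  have hs0 : s ≠ 0 := hS ▸ pow_ne_zero _ h.ne_zero
  have hysub : v (y * s - 1) ≤ v (1 - q ^ n) := Valuation.map_sub_one_mul_le hy1 hy hσ
  have hydiv : v (y / s - 1) ≤ v (1 - q ^ n) := by
    rw [div_eq_mul_inv]; exact Valuation.map_sub_one_mul_le hy1 hy hσ'
  have hy2s : v (y ^ 2 * s - 1) ≤ v (1 - q ^ n) :=
    Valuation.map_sub_one_mul_le (by rw [_root_.map_pow]; exact pow_le_one' hy1 2) hy2 hσ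
  refine v.map_sum_le fun r hr => ?_
  have hr' : r < n := by have := Finset.mem_range.1 hr; omega
  rw [← mul_sub, map_mul]
  have ha : v ((1 + y * q ^ (4 * r + 1)) * q ^ r) ≤ 1 := by
    rw [map_mul, h.map_pow, mul_one]
    refine v.map_add_le v.map_one.le ?_
    rw [map_mul, h.map_pow, mul_one]
    exact hy1
  refine (mul_le_mul' ha ?_).trans_eq (one_mul _)
  -- The triples are `(y², ys, s⁻¹)` above and `(1, y/s, y²s)` below, both of product `y³`.
  have hnum := map_qShifted_triple_sub_cube_le hw hy2 hysub hσ' hy (h.map_pow 2).le (h.map_pow 4).le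
    (by field_simp) r
  have hden := map_qShifted_triple_sub_cube_le hw (u₁ := 1) (by simp) hydiv hy2s hy
    (h.map_pow 4).le (h.map_pow 4).le (by field_simp) r
  rw [v.map_sub_swap] at hnum hden
  refine Valuation.map_div_sub_div_le ?_ ?_ ?_ hnum hden
  · have b {u : K} (hu : v (u - 1) ≤ v (1 - q ^ n)) : v (qShifted (u * q ^ 2) (q ^ 4) r) ≤ 1 := by
      refine map_qShifted_le_one ?_ (h.map_pow 4).le r
      rw [map_mul, h.map_pow, mul_one]
      exact Valuation.map_le_one_of_map_sub_one_le hw hu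
    rw [map_mul, map_mul]
    exact mul_le_one' (mul_le_one' (b hy2) (b hysub)) (b hσ')
  · rw [_root_.map_pow, h.map_qShifted_four hodd hy hr', one_pow]
  · rw [map_mul, map_mul, h.map_qShifted_four hodd (by simp) hr',
      h.map_qShifted_four hodd hydiv hr', h.map_qShifted_four hodd hy2s hr', one_mul, one_mul]

theorem map_blockValue_le (h : IsCyclotomicPlace v q n) {m : ℕ} (hn : n = 2 * m + 1)
    (h4 : n % 4 = 3) (j : ℕ) : v (blockValue q (q ^ (4 * (j * n))) m) ≤ v (1 - q ^ n) ^ 2 := by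
  have hodd : Odd n := ⟨m, hn⟩
  have hs : n ∣ 4 * m + 2 := Dvd.intro 2 (by omega)
  have hyd : n ∣ 4 * (j * n) := Dvd.intro_left (4 * j) (by ring)
  have hy := h.pow_sub_one_le hyd
  have hy2 : v ((q ^ (4 * (j * n))) ^ 2 - 1) ≤ v (1 - q ^ n) := by
    rw [← pow_mul]; exact h.pow_sub_one_le (hyd.mul_right 2)
  have hσ' := h.map_inv_pow_sub_one_le hs
  have hydiv : v (q ^ (4 * (j * n)) / q ^ (4 * m + 2) - 1) ≤ v (1 - q ^ n) := by
    rw [div_eq_mul_inv]; exact Valuation.map_sub_one_mul_le (h.map_pow _).le hy hσ'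
  rw [blockValue, map_div₀, map_mul, map_mul, h.map_qShifted_four hodd hydiv (by omega),
    map_qShifted_eq_one (a := q ^ (4 * (j * n)) * q ^ 5), mul_one, div_one, sq (v _)]
  -- Apart from powers congruent to `1`, the two small factors have exponents `6 + 4(m - 1) = 2n`
  -- and `3 + 4i = n`; the second needs `n ≡ 3 (mod 4)`.
  · exact mul_le_mul' (h.map_qShifted_le_of_dvd hy2 (i := m - 1) (by omega) (Dvd.intro 2 (by omega)))
      (h.map_qShifted_le_of_dvd hσ' (i := (n - 3) / 4) (by omega) (Dvd.intro 1 (by omega)))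
  · intro i hi
    rw [mul_assoc, ← pow_mul, ← pow_add]
    refine Valuation.map_one_sub_mul_eq_one (h.map_pow _).le (hy.trans_lt h.lt_one)
      -- As `0 < 5 + 4i < 2n`, only `5 + 4i = n` could occur, impossible modulo `4`.
      (h.eq_one _ fun ⟨c, hc⟩ => ?_)
    have hc2 : c < 2 := by
      by_contra hc2
      have := Nat.mul_le_mul_left n (show 2 ≤ c by omega)
      omega
    interval_cases c <;> omega

theorem map_sum_block_le (h : IsCyclotomicPlace v q n) {m : ℕ} (hn : n = 2 * m + 1)
    (h4 : n % 4 = 3) (j : ℕ) :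
    v (∑ r ∈ Finset.range (m + 1), summand q (j * n + r)) ≤ v (1 - q ^ n) ^ 2 := by
  have h' := h.map_sum_block_sub_le hn (by omega) j
  have e : v (blockFactor q n j *
      ((1 + q ^ (4 * (j * n)) * q) * blockValue q (q ^ (4 * (j * n))) m)) ≤ v (1 - q ^ n) ^ 2 := by
    rw [map_mul, h.map_blockFactor ⟨m, hn⟩ (by omega), one_mul, map_mul, ← pow_succ]
    exact (mul_le_mul' (v.map_add_le v.map_one.le (h.map_pow _).le)
      (h.map_blockValue_le hn h4 j)).trans_eq (one_mul _)
  simpa using v.map_add_le h' e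

theorem map_sum_tail_le (h : IsCyclotomicPlace v q n) {m : ℕ} (hn : n = 2 * m + 1) (h1 : n ≠ 1)
    (j : ℕ) :
    v (∑ r ∈ Finset.range m, summand q (j * n + (m + 1 + r))) ≤ v (1 - q ^ n) ^ 2 :=
  v.map_sum_le fun r hr => h.map_summand_le hn h1 j (by omega)
    (by have := Finset.mem_range.1 hr; omega)

theorem map_sum_range_mul_le (h : IsCyclotomicPlace v q n) (h4 : n % 4 = 3) (j : ℕ) :
    v (∑ k ∈ Finset.range (j * n), summand q k) ≤ v (1 - q ^ n) ^ 2 := by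
  obtain ⟨m, hn⟩ : Odd n := Nat.odd_iff.2 (by omega)
  induction j with
  | zero => simp
  | succ j ih =>
    rw [show (j + 1) * n = j * n + ((m + 1) + m) by rw [hn]; ring, Finset.sum_range_add,
      Finset.sum_range_add (fun r => summand q (j * n + r))]
    exact v.map_add_le ih (v.map_add_le (h.map_sum_block_le hn h4 j)
      (h.map_sum_tail_le hn (by omega) j))

theorem map_sum_range_mul_add_le (h : IsCyclotomicPlace v q n) {m : ℕ} (hn : n = 2 * m + 1)
    (h4 : n % 4 = 3) (j : ℕ) :
    v (∑ k ∈ Finset.range (j * n + (m + 1)), summand q k) ≤ v (1 - q ^ n) ^ 2 := by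
  rw [Finset.sum_range_add]
  exact v.map_add_le (h.map_sum_range_mul_le h4 j) (h.map_sum_block_le hn h4 j)

/-- One order comes from `[n²]_{q²}`. The first `mn` factors of the two products balance; of the
last `m`, the numerator has a non-unit and the denominator none. -/
theorem map_closedForm_sq_le (h : IsCyclotomicPlace v q n) {m : ℕ} (hn : n = 2 * m + 1)
    (h4 : n % 4 = 3) : v (closedForm q (n ^ 2)) ≤ v (1 - q ^ n) ^ 2 := by
  have hodd : Odd n := ⟨m, hn⟩
  have hN : (n ^ 2 - 1) / 2 = m * n + m := by
    have : n ^ 2 - 1 = 2 * (m * n + m) := by rw [hn]; ring_nf; omega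
    omega
  have hz : v (q ^ ((1 - ((n ^ 2 : ℕ) : ℤ)) / 2)) = 1 := by rw [map_zpow₀, h.map_q, one_zpow]
  have hI : v (qInteger (n ^ 2) (q ^ 2)) ≤ v (1 - q ^ n) := by
    have e := geom_sum_mul (q ^ 2) (n ^ 2)
    have h2 : v (q ^ 2 - 1) = 1 := by
      rw [v.map_sub_swap]
      exact h.eq_one _ fun hd => by have := Nat.le_of_dvd two_pos hd; omega
    have e' := congrArg v e
    rw [map_mul, h2, mul_one, ← pow_mul] at e'
    rw [qInteger, e']
    exact h.pow_sub_one_le ((dvd_pow_self n two_ne_zero).mul_left 2)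
  have h3 : v (qShifted (q ^ (4 * (m * n)) * q ^ 3) (q ^ 4) m) ≤ v (1 - q ^ n) :=
    h.map_qShifted_le_of_dvd (h.pow_sub_one_le (Dvd.intro_left (4 * m) (by ring)))
      (i := (n - 3) / 4) (by omega) (Dvd.intro 1 (by omega))
  have h5 : v (qShifted (q ^ (4 * (m * n)) * q ^ 5) (q ^ 4) m) = 1 := by
    refine map_qShifted_eq_one fun i hi => ?_
    rw [mul_assoc, ← pow_mul, ← pow_add]
    refine Valuation.map_one_sub_mul_eq_one (h.map_pow _).le
      ((h.pow_sub_one_le (Dvd.intro_left (4 * m) (by ring))).trans_lt h.lt_one)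
      (h.eq_one _ fun ⟨c, hc⟩ => ?_)
    have hc2 : c < 2 := by
      by_contra hc2
      have := Nat.mul_le_mul_left n (show 2 ≤ c by omega)
      omega
    interval_cases c <;> omega
  have e3 : q ^ 3 * (q ^ 4) ^ (m * n) = q ^ (4 * (m * n)) * q ^ 3 := by ring
  have e5 : q ^ 5 * (q ^ 4) ^ (m * n) = q ^ (4 * (m * n)) * q ^ 5 := by ring
  have hw0 := pow_ne_zero m (h.map_one_sub_ne_zero (by omega))
  rw [closedForm, map_mul, hz, mul_one, hN, qShifted_add, qShifted_add, e3, e5, map_div₀, map_mul,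
    map_mul, map_mul, h5, h.map_qShifted_mul hodd (by norm_num), h.map_qShifted_mul hodd (by norm_num),
    mul_one, sq (v _)]
  rw [mul_left_comm, mul_div_cancel_left₀ _ hw0]
  exact mul_le_mul' hI h3

/-- Factor `i` is paired with factor `m - 1 - i` through `1 - q⁻ᵉ = -q⁻ᵉ (1 - qᵉ)`; each pair
contributes one `q`. -/
theorem qShifted_inv_mul_reflect {q : K} (hq : q ≠ 0) (m : ℕ) :
    qShifted ((q ^ (4 * m + 2))⁻¹ * q ^ 3) (q ^ 4) m * qShifted (q ^ 2) (q ^ 4) m * q ^ m =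
      qShifted ((q ^ (4 * m + 2))⁻¹ * q ^ 4) (q ^ 4) m * qShifted (q ^ 3) (q ^ 4) m := by
  have e : q ^ m = ∏ _i ∈ Finset.range m, q := by simp
  rw [e]
  simp only [qShifted]
  rw [← Finset.prod_range_reflect (fun i => 1 - q ^ 2 * (q ^ 4) ^ i),
    ← Finset.prod_range_reflect (fun i => 1 - q ^ 3 * (q ^ 4) ^ i),
    ← Finset.prod_mul_distrib, ← Finset.prod_mul_distrib, ← Finset.prod_mul_distrib]
  refine Finset.prod_congr rfl fun i hi => ?_
  obtain ⟨d, rfl⟩ := Nat.exists_eq_add_of_lt (Finset.mem_range.1 hi)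
  rw [show i + d + 1 - 1 - i = d by omega]
  have hi0 : q ^ i ≠ 0 := pow_ne_zero _ hq
  have hd0 : q ^ d ≠ 0 := pow_ne_zero _ hq
  have es : q ^ (4 * (i + d + 1) + 2) = (q ^ i) ^ 4 * (q ^ d) ^ 4 * q ^ 6 := by ring
  rw [es, pow_right_comm q 4 i, pow_right_comm q 4 d]
  generalize q ^ i = x at *
  generalize q ^ d = z at *
  field_simp
  ring

theorem blockFactor_mul_blockValue_eq (h : IsCyclotomicPlace v q n) {m : ℕ}
    (hn : n = 2 * m + 1) :
    blockFactor q n 0 * ((1 + q ^ (4 * (0 * n)) * q) * blockValue q (q ^ (4 * (0 * n))) m) =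
      closedForm q n := by
  have hq := h.ne_zero
  have d2 : 1 - q ^ 2 ≠ 0 := sub_ne_zero.2 (h.pow_ne_one 2 two_ne_zero).symm
  have d1 : 1 + q ≠ 0 := fun h0 => d2 (by linear_combination (1 - q) * h0)
  have hA : qInteger n (q ^ 2) * qShifted (q ^ 2) (q ^ 4) m = qShifted (q ^ 6) (q ^ 4) m := by
    have e1 := geom_sum_mul (q ^ 2) n
    have e2 := (qShifted_succ (q ^ 2) (q ^ 4) m).symm.trans (qShifted_succ' _ _ _)
    rw [show q ^ 2 * (q ^ 4) ^ m = (q ^ 2) ^ n by rw [hn]; ring,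
      show q ^ 2 * q ^ 4 = q ^ 6 by ring] at e2
    rw [qInteger]
    refine mul_left_cancel₀ d2 ?_
    linear_combination e2 - qShifted (q ^ 2) (q ^ 4) m * e1
  have hB := qShifted_inv_mul_reflect hq m
  have nat {e : ℕ} (he : e ≠ 0) : qShifted (q ^ e) (q ^ 4) m ≠ 0 :=
    qShifted_ne_zero fun i => by rw [← pow_mul, ← pow_add]; exact h.pow_ne_one _ (by omega)
  have n2 : qShifted (q ^ 2) (q ^ 4) m ≠ 0 := nat two_ne_zero
  have n5 : qShifted (q ^ 5) (q ^ 4) m ≠ 0 := nat (by norm_num)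
  have n4 : qShifted ((q ^ (4 * m + 2))⁻¹ * q ^ 4) (q ^ 4) m ≠ 0 := by
    refine qShifted_ne_zero fun i hi => ?_
    rw [mul_assoc, inv_mul_eq_one₀ (pow_ne_zero _ hq), ← pow_mul, ← pow_add] at hi
    have := h.pow_inj hi
    omega
  have hz : q ^ ((1 - (n : ℤ)) / 2) = (q ^ m)⁻¹ := by
    rw [show (1 - (n : ℤ)) / 2 = -(m : ℤ) by omega, zpow_neg, zpow_natCast]
  rw [closedForm, hz, show (n - 1) / 2 = m by omega]
  simp only [blockFactor, blockValue, zero_mul, mul_zero, pow_zero, one_mul, qShifted_zero, div_one,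
    one_pow, one_div]
  rw [inv_mul_cancel_left₀ d1, ← hA]
  generalize qShifted ((q ^ (4 * m + 2))⁻¹ * q ^ 4) (q ^ 4) m = A at *
  generalize qShifted ((q ^ (4 * m + 2))⁻¹ * q ^ 3) (q ^ 4) m = B at *
  field_simp
  linear_combination qInteger n (q ^ 2) * hB

/-- No residue modulo `4` is imposed, so `n²` is admissible although `n² ≡ 1`. -/
theorem map_sum_range_sub_closedForm_le (h : IsCyclotomicPlace v q n) {m : ℕ}
    (hn : n = 2 * m + 1) (h1 : n ≠ 1) :
    v (∑ k ∈ Finset.range (m + 1), summand q k - closedForm q n) ≤ v (1 - q ^ n) ^ 2 := by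
  have h' := h.map_sum_block_sub_le hn h1 0
  rw [h.blockFactor_mul_blockValue_eq hn] at h'
  simpa using h'

theorem map_sum_range_self_sub_closedForm_le (h : IsCyclotomicPlace v q n) {m : ℕ}
    (hn : n = 2 * m + 1) (h1 : n ≠ 1) :
    v (∑ k ∈ Finset.range n, summand q k - closedForm q n) ≤ v (1 - q ^ n) ^ 2 := by
  have h2 := h.map_sum_tail_le hn h1 0
  rw [show Finset.range n = Finset.range (m + 1 + m) by rw [hn]; congr 1; ring,
    Finset.sum_range_add, add_sub_right_comm]
  refine v.map_add_le (h.map_sum_range_sub_closedForm_le hn h1) ?_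
  simpa using h2

end IsCyclotomicPlace

/-! ### The `Φ_n`-adic valuation on `ℚ(q)` -/

section CyclotomicValuation

open IsDedekindDomain Polynomial

/-- The prime ideal of `ℚ[X]` generated by the cyclotomic polynomial `Φ_n`. -/
noncomputable def cyclotomicPrime (n : ℕ) [NeZero n] : HeightOneSpectrum ℚ[X] where
  asIdeal := Ideal.span {cyclotomic n ℚ}
  isPrime := (Ideal.span_singleton_prime (cyclotomic_ne_zero n ℚ)).2
    (cyclotomic.irreducible_rat (NeZero.pos n)).prime
  ne_bot := by simpa using cyclotomic_ne_zero n ℚ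

theorem mem_cyclotomicPrime_iff {n : ℕ} [NeZero n] {ζ : ℂ} (hζ : IsPrimitiveRoot ζ n) {p : ℚ[X]} :
    p ∈ (cyclotomicPrime n).asIdeal ↔ aeval ζ p = 0 := by
  rw [cyclotomicPrime, Ideal.mem_span_singleton, cyclotomic_eq_minpoly_rat hζ (NeZero.pos n),
    minpoly.dvd_iff]

theorem isCyclotomicPlace_cyclotomicPrime (n : ℕ) [NeZero n] :
    IsCyclotomicPlace ((cyclotomicPrime n).valuation (RatFunc ℚ)) RatFunc.X n := by
  have hζ := Complex.isPrimitiveRoot_exp n (NeZero.ne n)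
  set ζ := Complex.exp (2 * Real.pi * Complex.I / n)
  have ne1 (e : ℕ) : (1 : RatFunc ℚ) - RatFunc.X ^ e = algebraMap ℚ[X] _ (1 - X ^ e) := by
    simp [RatFunc.algebraMap_X]
  refine ⟨?_, ?_, ?_, ?_, ?_⟩
  · rw [← RatFunc.algebraMap_X, HeightOneSpectrum.valuation_eq_one_iff_notMem,
      mem_cyclotomicPrime_iff hζ]
    simpa using hζ.ne_zero (NeZero.ne n)
  · rw [ne1]
    refine (HeightOneSpectrum.valuation_lt_one_iff_mem _ _).2 ?_
    rw [mem_cyclotomicPrime_iff hζ]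
    simp [hζ.pow_eq_one]
  · intro e he h
    have h' : (1 : RatFunc ℚ) - RatFunc.X ^ e = 0 := by rw [h, sub_self]
    rw [ne1, map_eq_zero_iff _ (IsFractionRing.injective ℚ[X] (RatFunc ℚ))] at h'
    exact X_pow_sub_C_ne_zero (Nat.pos_of_ne_zero he) (1 : ℚ) (by
      rw [map_one]; linear_combination -h')
  · intro e he
    rw [ne1, HeightOneSpectrum.valuation_eq_one_iff_notMem, mem_cyclotomicPrime_iff hζ]
    intro h
    refine he (hζ.dvd_of_pow_eq_one e ?_)
    rw [map_sub, map_one, map_pow, aeval_X, sub_eq_zero] at h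
    exact h.symm
  -- The cofactor `∑ X ^ (ni)` takes the value `c ≠ 0` at `ζ`, hence is a unit.
  · rintro _ he ⟨c, rfl⟩
    have e : (1 : RatFunc ℚ) - RatFunc.X ^ (n * c) =
        algebraMap ℚ[X] _ (∑ i ∈ Finset.range c, (X ^ n) ^ i) * (1 - RatFunc.X ^ n) := by
      rw [ne1, ne1, ← map_mul]
      congr 1
      have := geom_sum_mul (X ^ n : ℚ[X]) c
      rw [← pow_mul] at this
      linear_combination this
    rw [e, map_mul, (HeightOneSpectrum.valuation_eq_one_iff_notMem _).2, one_mul]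
    rw [mem_cyclotomicPrime_iff hζ]
    simpa [hζ.pow_eq_one] using right_ne_zero_of_mul he

/-- The numerator is `f` times its denominator, which is integral, so it inherits the bound. -/
theorem cyclotomic_sq_dvd_num {n : ℕ} [NeZero n] {f : RatFunc ℚ}
    (hf : (cyclotomicPrime n).valuation (RatFunc ℚ) f ≤
      (cyclotomicPrime n).valuation (RatFunc ℚ) (1 - RatFunc.X ^ n) ^ 2) :
    cyclotomic n ℚ ^ 2 ∣ f.num := by
  have hw : (cyclotomicPrime n).valuation (RatFunc ℚ) (1 - RatFunc.X ^ n) ≤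
      WithZero.exp (-((1 : ℕ) : ℤ)) := by
    have e : (1 : RatFunc ℚ) - RatFunc.X ^ n = algebraMap ℚ[X] _ (1 - X ^ n) := by
      simp [RatFunc.algebraMap_X]
    rw [e, HeightOneSpectrum.valuation_of_algebraMap,
      HeightOneSpectrum.intValuation_le_pow_iff_mem, pow_one, cyclotomicPrime,
      Ideal.mem_span_singleton, ← dvd_neg, neg_sub]
    exact cyclotomic.dvd_X_pow_sub_one n ℚ
  have hd : algebraMap ℚ[X] (RatFunc ℚ) f.denom ≠ 0 := by simp [RatFunc.denom_ne_zero]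
  have hnum : (cyclotomicPrime n).valuation (RatFunc ℚ) (algebraMap ℚ[X] _ f.num) ≤
      WithZero.exp (-((2 : ℕ) : ℤ)) := by
    rw [(div_eq_iff hd).1 f.num_div_denom, map_mul]
    refine (mul_le_mul' (hf.trans (pow_le_pow_left' hw 2))
      (HeightOneSpectrum.valuation_le_one _ _)).trans_eq ?_
    rw [mul_one, ← WithZero.exp_nsmul]
    rfl
  rwa [HeightOneSpectrum.valuation_of_algebraMap, HeightOneSpectrum.intValuation_le_pow_iff_mem,
    cyclotomicPrime, Ideal.span_singleton_pow, Ideal.mem_span_singleton] at hnum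

end CyclotomicValuation

theorem theorem2 (n : ℕ) (hn : n % 4 = 3) :
    RatFuncCongr (Polynomial.cyclotomic n ℚ ^ 2 * Polynomial.cyclotomic (n ^ 2) ℚ ^ 2)
      (∑ k ∈ Finset.range ((n ^ 2 - 1) / 2 + 1), summand (RatFunc.X : RatFunc ℚ) k)
      (closedForm (RatFunc.X : RatFunc ℚ) (n ^ 2)) ∧
    RatFuncCongr (Polynomial.cyclotomic n ℚ ^ 2 * Polynomial.cyclotomic (n ^ 2) ℚ ^ 2)
      (∑ k ∈ Finset.range (n ^ 2 - 1 + 1), summand (RatFunc.X : RatFunc ℚ) k)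
      (closedForm (RatFunc.X : RatFunc ℚ) (n ^ 2)) := by
  obtain ⟨m, hm⟩ : Odd n := Nat.odd_iff.2 (by omega)
  have : NeZero n := ⟨by omega⟩
  have hN : n ^ 2 = 2 * (m * n + m) + 1 := by rw [hm]; ring
  have hN1 : n ^ 2 ≠ 1 := by
    rw [Ne, Nat.pow_eq_one]
    omega
  have hcop : IsCoprime (Polynomial.cyclotomic n ℚ ^ 2) (Polynomial.cyclotomic (n ^ 2) ℚ ^ 2) := by
    refine (Polynomial.cyclotomic.isCoprime_rat fun h => ?_).pow
    have : n * 1 = n * n := by rw [← sq, ← h, mul_one]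
    have := Nat.eq_of_mul_eq_mul_left (by omega) this
    omega
  have hv := isCyclotomicPlace_cyclotomicPrime n
  have hV := isCyclotomicPlace_cyclotomicPrime (n ^ 2)
  have hc := hv.map_closedForm_sq_le hm hn
  -- Modulo `Φ_n²` the short sum is `m` full blocks and the first `m + 1` terms of another; the long
  -- sum is `n` full blocks.
  rw [show (n ^ 2 - 1) / 2 + 1 = m * n + (m + 1) by omega,
    show n ^ 2 - 1 + 1 = n ^ 2 by omega]
  refine ⟨hcop.mul_dvd (cyclotomic_sq_dvd_num ?_) (cyclotomic_sq_dvd_num ?_),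
    hcop.mul_dvd (cyclotomic_sq_dvd_num ?_) (cyclotomic_sq_dvd_num ?_)⟩
  · exact Valuation.map_sub_le _ (hv.map_sum_range_mul_add_le hm hn m) hc
  · exact hV.map_sum_range_sub_closedForm_le hN hN1
  · refine Valuation.map_sub_le _ ?_ hc
    have := hv.map_sum_range_mul_le hn n
    rwa [← sq] at this
  · exact hV.map_sum_range_self_sub_closedForm_le hN hN1
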